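/- For $N\ge 1$ let $|\cdot|$ be the Euclidean norm on $\mathbb R^N$ and $\sigma_{N-1}$ the surface area of the unit sphere $\mathbb S^{N-1}$ (so $\sigma_0=2$). For $\gamma\in\mathbb R$ let $\nu_\gamma$ be the measure on $\mathbb R^N\times\mathbb R^N$ given by \[ \nu_\gamma(E)=\iint_{(x,y)\in E,\ x\ne y}|x-y|^{\gamma-N}\,dx\,dy , \] and for a measurable $u:\mathbb R^N\to\mathbb R$, $b\in\mathbb R$ and $\lambda>0$ put \[ E_{\lambda,b}[u]=\Big\{(x,y)\in\mathbb R^N\times\mathbb R^N:\ x\neq y,\ \frac{|u(x)-u(y)|}{|x-y|^{1+b}}>\lambda\Big\}. \] Let $\dot W^{1,p}(\mathbb R^N)$ be the space of locally integrable $u:\mathbb R^N\to\mathbb R$ whose distributional gradient $\nabla u$ belongs to $L^p(\mathbb R^N)$, and let $\dot{BV}(\mathbb R^N)$ be the space of locally integrable $u:\mathbb R^N\to\mathbb R$ for which \[ \|\nabla u\|_{\mathcal M}=\sup\Big\{\Big|\int_{\mathbb R^N}u\,\operatorname{div}\phi\,dx\Big|:\ \phi\in C^1_c(\mathbb R^N,\mathbb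 R^N),\ \sup_x|\phi(x)|\le 1\Big\}<\infty . \] \textbf{Theorem 2.2.} There exists an absolute constant $C>0$ such that for every $N\ge 1$, every $1\le p<\infty$ and every $u\in\dot W^{1,p}(\mathbb R^N)$: (a) if $\gamma>0$, then \[ \sup_{\lambda>0}\lambda^p\,\nu_\gamma(E_{\lambda,\gamma/p}[u])\le C\,\sigma_{N-1}\,\frac{5^\gamma}{\gamma}\,\|\nabla u\|_{L^p(\mathbb R^N)}^p ; \] (b) if $\gamma<-1$, then \[ \sup_{\lambda>0}\lambda^p\,\nu_\gamma(E_{\lambda,\gamma/p}[u])\le \frac{C\,\sigma_{N-1}}{|\gamma|}\Big(1+\frac1{|\gamma+1|}\Big)\|\nabla u\|_{L^p(\mathbb R^N)}^p . \] Moreover, for $p=1$, the estimates (a) and (b) hold (with the same constant $C$) for all $u\in\dot{BV}(\mathbb R^N)$ if $\|\nabla u\|_{L^1(\mathbb R^N)}$ is replaced by $\|\nabla u\|_{\mathcal M}$. -/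

import Mathlib

open MeasureTheory
open scoped ENNReal ContDiff

noncomputable section

namespace DiffQuotient

/-- `ℝ^N` with its Euclidean norm; its `volume` is Lebesgue measure. -/
abbrev Rn (N : ℕ) : Type := EuclideanSpace ℝ (Fin N)

/-- The surface area `σ_{N-1}` of the unit sphere of `ℝ^N`
(for `N = 1` the sphere consists of two points, and its area is `2`). -/
def sphereArea (N : ℕ) : ℝ :=
  ((volume : Measure (Rn N)).toSphere).real Set.univ

/-- The measure `ν_γ`, `dν_γ(x, y) = |x - y|^(γ - N) dx dy` off the diagonal of `ℝ^N × ℝ^N`. -/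
def nu (N : ℕ) (γ : ℝ) : Measure (Rn N × Rn N) :=
  ((volume : Measure (Rn N × Rn N)).restrict {z | z.1 ≠ z.2}).withDensity
    (fun z => ENNReal.ofReal (‖z.1 - z.2‖ ^ (γ - (N : ℝ))))

/-- The difference quotient `Q_b u(x, y) = (u(x) - u(y)) / |x - y|^(1 + b)`
(only used for `x ≠ y`). -/
def quot {N : ℕ} (b : ℝ) (u : Rn N → ℝ) (x y : Rn N) : ℝ :=
  (u x - u y) / ‖x - y‖ ^ (1 + b)

/-- The superlevel set `E_{l,b}[u]` of `|Q_b u|` at height `l`. -/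
def superlevel {N : ℕ} (l b : ℝ) (u : Rn N → ℝ) : Set (Rn N × Rn N) :=
  {z | z.1 ≠ z.2 ∧ l < |quot b u z.1 z.2|}

/-- `sup_{l > 0} l^p ν_γ(E_{l,γ/p}[u])`, with values in `[0, ∞]`. -/
def weakQuotient {N : ℕ} (p γ : ℝ) (u : Rn N → ℝ) : ℝ≥0∞ :=
  ⨆ (l : ℝ) (_ : 0 < l), ENNReal.ofReal (l ^ p) * nu N γ (superlevel l (γ / p) u)

/-- The locally integrable vector field `g` is the distributional gradient of `u`. -/
def HasWeakGradient {N : ℕ} (u : Rn N → ℝ) (g : Rn N → Rn N) : Prop :=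
  LocallyIntegrable g ∧
    ∀ φ : Rn N → ℝ, ContDiff ℝ ∞ φ → HasCompactSupport φ → ∀ i : Fin N,
      ∫ x, u x * fderiv ℝ φ x (EuclideanSpace.single i 1) = -∫ x, g x i * φ x

/-- The homogeneous Sobolev space `Ẇ^{1,p}(ℝ^N)`. -/
def HomSobolev (N : ℕ) (p : ℝ) : Set (Rn N → ℝ) :=
  {u | LocallyIntegrable u ∧
    ∃ g : Rn N → Rn N, HasWeakGradient u g ∧ MemLp g (ENNReal.ofReal p)}

/-- The divergence of a differentiable vector field. -/
def divergence {N : ℕ} (φ : Rn N → Rn N) (x : Rn N) : ℝ :=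
  ∑ i : Fin N, fderiv ℝ φ x (EuclideanSpace.single i 1) i

/-- The total variation `‖∇u‖_ℳ`, with values in `[0, ∞]`: the supremum of `|∫ u div φ|` over
`C^1` compactly supported vector fields with `|φ| ≤ 1`. -/
def totalVariation {N : ℕ} (u : Rn N → ℝ) : ℝ≥0∞ :=
  ⨆ (φ : Rn N → Rn N) (_ : ContDiff ℝ 1 φ) (_ : HasCompactSupport φ) (_ : ∀ x, ‖φ x‖ ≤ 1),
    ENNReal.ofReal |∫ x, u x * divergence φ x|

/-- The homogeneous space of functions of bounded variation on `ℝ^N`. -/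
def HomBV (N : ℕ) : Set (Rn N → ℝ) :=
  {u | LocallyIntegrable u ∧ totalVariation u < ⊤}

end DiffQuotient

end

namespace DiffQuotient
open Set Filter Topology
open scoped Convolution

/-! The estimate is one-dimensional. With `y = x + r • e`, polar coordinates turn `ν_γ` of the
superlevel set into an average over directions `e` of the measure of pairs `(x, r)` with a large
increment, weighted by `r ^ (γ - 1)`; slicing along lines parallel to `e` leaves a problem on each
line. There the fundamental theorem of calculus and Jensen's inequality show that a large increment
over `[s, s + r]` makes this interval heavy: its mass for `m = |∂_e u|^p ds` exceeds `l ^ p * r ^ (1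
+ γ)`.

Heavy intervals are counted by a Vitali covering. Every heavy interval meets a selected one, of
length `L` say, so its left endpoint lies in a window of length `L + r`. For `γ > 0` long intervals
are selected first, so `r ≤ 2 * L`; for `γ < -1` short ones come first, so `r ≥ L / τ`. In both
cases the weighted measure of the pairs attached to one selected interval is at most a constant
times `L ^ (1 + γ)`, hence is controlled by its mass, and disjointness sums these masses to at most
`m univ`. This is `lintegral_heavyIntervals_pos` and `lintegral_heavyIntervals_neg`.

All this is done for `C^1` functions and applied to mollifications of `u`. Their directional
derivatives are bounded in `L^p` by the gradient of `u` (or, for `p = 1`, by its total variation),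
uniformly in the mollifier, and the bound passes to an a.e. limit because the superlevel sets are
defined by strict inequalities. -/

/-! ### Covering estimates for heavy intervals on the line -/

/-- Integrating a weight in the length variable over a region of pairs (left endpoint, length). -/
theorem lintegral_interval_region (S : Set ℝ) (hS : MeasurableSet S) (w : ℝ → ℝ≥0∞)
    (hw : Measurable w) (a b : ℝ) :
    ∫⁻ q in {q : ℝ × ℝ | q.2 ∈ S ∧ q.1 ∈ Icc (a - q.2) b}, w q.2 =
      ∫⁻ r in S, w r * ENNReal.ofReal (b - a + r) := by
  have hD : MeasurableSet {q : ℝ × ℝ | q.2 ∈ S ∧ q.1 ∈ Icc (a - q.2) b} := by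
    refine (measurable_snd hS).inter ?_
    exact (measurableSet_le (measurable_const.sub measurable_snd) measurable_fst).inter
      (measurableSet_le measurable_fst measurable_const)
  rw [← lintegral_indicator hD, ← lintegral_indicator hS, Measure.volume_eq_prod,
    lintegral_prod_symm' (μ := volume) (ν := volume) _
      (Measurable.indicator (f := fun q : ℝ × ℝ => w q.2) (hw.comp measurable_snd) hD)]
  refine lintegral_congr fun r => ?_
  by_cases hr : r ∈ S
  · have : ∀ s : ℝ, ({q : ℝ × ℝ | q.2 ∈ S ∧ q.1 ∈ Icc (a - q.2) b}.indicator (fun q => w q.2)) (s, r)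
        = (Icc (a - r) b).indicator (fun _ => w r) s := by
      intro s
      by_cases hs : s ∈ Icc (a - r) b
      · rw [indicator_of_mem hs, indicator_of_mem]
        exact ⟨hr, hs⟩
      · rw [indicator_of_notMem hs, indicator_of_notMem]
        exact fun h => hs h.2
    simp_rw [this]
    rw [lintegral_indicator measurableSet_Icc, setLIntegral_const, Real.volume_Icc,
      indicator_of_mem hr]
    congr 2
    ring
  · have : ∀ s : ℝ,
        ({q : ℝ × ℝ | q.2 ∈ S ∧ q.1 ∈ Icc (a - q.2) b}.indicator (fun q => w q.2)) (s, r) = 0 := by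
      intro s
      rw [indicator_of_notMem]
      exact fun h => hr h.1
    simp [hr]

/-- Summing local estimates over a disjoint family of intervals. -/
theorem setLIntegral_le_of_disjoint_intervals (m : Measure ℝ) (A U : Set (ℝ × ℝ))
    (w : ℝ × ℝ → ℝ≥0∞) (k : ℝ≥0∞) (D : ℝ × ℝ → Set (ℝ × ℝ))
    (hdisj : U.PairwiseDisjoint fun z => Icc z.1 (z.1 + z.2)) (hpos : ∀ z ∈ U, 0 < z.2)
    (hcov : ∀ q ∈ A, ∃ z ∈ U, q ∈ D z)
    (hD : ∀ z ∈ U, ∫⁻ q in D z, w q ≤ k * m (Icc z.1 (z.1 + z.2))) :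
    ∫⁻ q in A, w q ≤ k * m univ := by
  -- Countability is what permits subadditivity over `U`; disjoint intervals of positive length
  -- provide it.
  have hc : U.Countable := hdisj.countable_of_nonempty_interior fun z hz => by
    rw [interior_Icc]
    exact nonempty_Ioo.2 (by linarith [hpos z hz])
  have : Countable U := hc
  calc ∫⁻ q in A, w q ≤ ∫⁻ q in ⋃ z : U, D z, w q := by
        refine lintegral_mono_set fun q hq => ?_
        obtain ⟨z, hz, hqz⟩ := hcov q hq
        exact mem_iUnion.2 ⟨⟨z, hz⟩, hqz⟩
    _ ≤ ∑' z : U, ∫⁻ q in D z, w q := lintegral_iUnion_le _ _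
    _ ≤ ∑' z : U, k * m (Icc z.1.1 (z.1.1 + z.1.2)) := ENNReal.tsum_le_tsum fun z => hD z z.2
    _ = k * ∑' z : U, m (Icc z.1.1 (z.1.1 + z.1.2)) := ENNReal.tsum_mul_left
    _ ≤ k * m univ := by
        gcongr
        refine tsum_measure_le_measure_univ (fun _ => measurableSet_Icc.nullMeasurableSet) ?_
        intro i j hij
        exact (hdisj i.2 j.2 fun h => hij (Subtype.ext h)).aedisjoint

/-- The pairs (left endpoint, length) of intervals on which `m` is large. -/
def heavyIntervals (m : Measure ℝ) (γ μ : ℝ) : Set (ℝ × ℝ) :=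
  {q | 0 < q.2 ∧ ENNReal.ofReal (μ * q.2 ^ (1 + γ)) < m (Icc q.1 (q.1 + q.2))}

theorem mem_interval_of_inter_nonempty {x r y s : ℝ}
    (h : (Icc x (x + r) ∩ Icc y (y + s)).Nonempty) : x ∈ Icc (y - r) (y + s) := by
  obtain ⟨t, ht, ht'⟩ := h
  simp only [mem_Icc] at *
  constructor <;> linarith

/-- This gives the a priori bound on lengths that Vitali selection needs: from above if `1 + γ > 0`,
from below if `1 + γ < 0`. -/
theorem mul_rpow_lt_toReal {m : Measure ℝ} {γ μ : ℝ} (hμ : 0 < μ) (hm : m univ ≠ ⊤)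
    {q : ℝ × ℝ} (hq : q ∈ heavyIntervals m γ μ) : μ * q.2 ^ (1 + γ) < (m univ).toReal := by
  have := hq.2.trans_le (measure_mono (subset_univ _))
  exact (ENNReal.ofReal_lt_iff_lt_toReal (mul_nonneg hμ.le (Real.rpow_nonneg hq.1.le _)) hm).1 this

/-- Vitali selection by length with enlargement factor 2. An interval attached to a selected one of
length `L` has `r ≤ 2 * L` and a window of length at most `3 * L`, and the weight is integrable at
`0`; this gives `3 * L * (2 * L) ^ γ / γ`. -/
theorem lintegral_heavyIntervals_pos (m : Measure ℝ) {γ μ : ℝ} (hγ : 0 < γ) (hμ : 0 < μ) :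
    ∫⁻ q in heavyIntervals m γ μ, ENNReal.ofReal (q.2 ^ (γ - 1)) ≤
      ENNReal.ofReal (3 * 2 ^ γ / γ / μ) * m univ := by
  by_cases hm : m univ = ⊤
  · rw [hm, ENNReal.mul_top]
    · exact le_top
    · simp only [ne_eq, ENNReal.ofReal_eq_zero, not_le]
      positivity
  obtain ⟨U, hUA, hdisj, hU⟩ := Vitali.exists_disjoint_subfamily_covering_enlargement
    (fun z : ℝ × ℝ => Icc z.1 (z.1 + z.2)) (heavyIntervals m γ μ) (fun z => z.2) 2 one_lt_two
    (fun z hz => hz.1.le) (((m univ).toReal / μ) ^ (1 + γ)⁻¹)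
    (fun z hz => by
      have h := mul_rpow_lt_toReal hμ hm hz
      rw [Real.le_rpow_inv_iff_of_pos hz.1.le (by positivity) (by linarith), le_div_iff₀ hμ]
      linarith)
    (fun z hz => nonempty_Icc.2 (by linarith [hz.1]))
  refine setLIntegral_le_of_disjoint_intervals m _ U _ _
    (fun z => {q | q.2 ∈ Ioc 0 (2 * z.2) ∧ q.1 ∈ Icc (z.1 - q.2) (z.1 + z.2)}) hdisj
    (fun z hz => (hUA hz).1) ?_ ?_
  · intro q hq
    obtain ⟨z, hz, h1, h2⟩ := hU q hq
    exact ⟨z, hz, ⟨hq.1, h2⟩, mem_interval_of_inter_nonempty h1⟩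
  · intro z hz
    obtain ⟨hz0, hz1⟩ := hUA hz
    rw [lintegral_interval_region _ measurableSet_Ioc (fun r => ENNReal.ofReal (r ^ (γ - 1)))
      (by fun_prop)]
    calc ∫⁻ r in Ioc 0 (2 * z.2), ENNReal.ofReal (r ^ (γ - 1)) *
            ENNReal.ofReal (z.1 + z.2 - z.1 + r)
        ≤ ∫⁻ r in Ioc 0 (2 * z.2), ENNReal.ofReal (3 * z.2) * ENNReal.ofReal (r ^ (γ - 1)) := by
          refine setLIntegral_mono (by fun_prop) fun r hr => ?_
          rw [mul_comm]
          gcongr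
          linarith [hr.2]
      _ = ENNReal.ofReal (3 * z.2) * ENNReal.ofReal ((2 * z.2) ^ γ / γ) := by
          rw [lintegral_const_mul _ (by fun_prop)]
          congr 1
          have hint : IntervalIntegrable (fun r : ℝ => r ^ (γ - 1)) volume 0 (2 * z.2) :=
            intervalIntegral.intervalIntegrable_rpow' (by linarith)
          rw [← ofReal_integral_eq_lintegral_ofReal
            ((intervalIntegrable_iff_integrableOn_Ioc_of_le (by linarith)).1 hint),
            ← intervalIntegral.integral_of_le (by linarith), integral_rpow (by left; linarith)]
          · simp [Real.zero_rpow hγ.ne']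
          · filter_upwards [ae_restrict_mem measurableSet_Ioc] with r hr
            exact Real.rpow_nonneg hr.1.le _
      _ = ENNReal.ofReal (3 * 2 ^ γ / γ / μ) * ENNReal.ofReal (μ * z.2 ^ (1 + γ)) := by
          rw [← ENNReal.ofReal_mul (by positivity), ← ENNReal.ofReal_mul (by positivity)]
          congr 1
          rw [Real.mul_rpow (by norm_num) hz0.le, Real.rpow_add hz0, Real.rpow_one]
          field_simp
      _ ≤ _ := by gcongr

/-- Keeps the loss from the enlargement factor in the case `γ < -1` bounded as `γ → -∞`. -/
theorem one_add_inv_rpow_le {a : ℝ} (ha : 0 < a) : (1 + 1 / (1 + a)) ^ a ≤ 3 := by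
  calc (1 + 1 / (1 + a)) ^ a ≤ Real.exp (1 / (1 + a)) ^ a := by
        gcongr
        linarith [Real.add_one_le_exp (1 / (1 + a))]
    _ = Real.exp (1 / (1 + a) * a) := (Real.exp_mul _ _).symm
    _ ≤ Real.exp 1 := by
        gcongr
        rw [one_div_mul_eq_div, div_le_one (by linarith)]
        linarith
    _ ≤ 3 := by linarith [Real.exp_one_lt_d9]

/-- The selection is by inverse length, since the weight is now integrable at infinity and heavy
intervals of a finite measure cannot be too short. Attached lengths satisfy `r ≥ L / τ`, so the
window has length at most `3 * r` and the integral is that of `3 * r ^ γ`, convergent because `γ <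
-1`. -/
theorem lintegral_heavyIntervals_neg (m : Measure ℝ) {γ μ : ℝ} (hγ : γ < -1) (hμ : 0 < μ) :
    ∫⁻ q in heavyIntervals m γ μ, ENNReal.ofReal (q.2 ^ (γ - 1)) ≤
      ENNReal.ofReal (9 / |γ + 1| / μ) * m univ := by
  obtain ⟨a, rfl⟩ : ∃ a, γ = -1 - a := ⟨-1 - γ, by ring⟩
  have ha : 0 < a := by linarith
  have habs : |-1 - a + 1| = a := by rw [show -1 - a + 1 = -a by ring, abs_neg, abs_of_pos ha]
  rw [habs]
  have hexp : 1 + (-1 - a) = -a := by ring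
  by_cases hm : m univ = ⊤
  · rw [hm, ENNReal.mul_top]
    · exact le_top
    · simp only [ne_eq, ENNReal.ofReal_eq_zero, not_le]
      positivity
  -- The factor `τ ^ a` enters the constant. A fixed `τ` would make it exponential in `a`; this
  -- choice keeps it below 3, and `τ ≤ 2` gives the window bound `3 * r`.
  set τ : ℝ := 1 + 1 / (1 + a) with hτ
  have hτ1 : 1 < τ := by
    have : 0 < 1 / (1 + a) := by positivity
    linarith
  have hτ2 : τ ≤ 2 := by
    have : 1 / (1 + a) ≤ 1 := by rw [div_le_one (by linarith)]; linarith
    linarith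
  obtain ⟨U, hUA, hdisj, hU⟩ := Vitali.exists_disjoint_subfamily_covering_enlargement
    (fun z : ℝ × ℝ => Icc z.1 (z.1 + z.2)) (heavyIntervals m (-1 - a) μ) (fun z => z.2⁻¹) τ hτ1
    (fun z hz => inv_nonneg.2 hz.1.le) (((m univ).toReal / μ) ^ a⁻¹)
    (fun z hz => by
      have h := mul_rpow_lt_toReal hμ hm hz
      have hz0 := hz.1
      rw [Real.le_rpow_inv_iff_of_pos (by positivity) (by positivity) ha, le_div_iff₀ hμ,
        Real.inv_rpow hz0.le, ← Real.rpow_neg hz0.le]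
      rw [hexp] at h
      linarith)
    (fun z hz => nonempty_Icc.2 (by linarith [hz.1]))
  refine setLIntegral_le_of_disjoint_intervals m _ U _ _
    (fun z => {q | q.2 ∈ Ici (z.2 / τ) ∧ q.1 ∈ Icc (z.1 - q.2) (z.1 + z.2)}) hdisj
    (fun z hz => (hUA hz).1) ?_ ?_
  · intro q hq
    obtain ⟨z, hz, h1, h2⟩ := hU q hq
    refine ⟨z, hz, ?_, mem_interval_of_inter_nonempty h1⟩
    have hz0 := (hUA hz).1
    have hq0 := hq.1
    rw [mem_Ici, div_le_iff₀ (by linarith)]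
    rw [← div_eq_mul_inv, inv_le_comm₀ hq0 (by positivity), inv_div, div_le_iff₀ (by linarith)] at h2
    exact h2
  · intro z hz
    obtain ⟨hz0, hz1⟩ := hUA hz
    have hc : 0 < z.2 / τ := by positivity
    rw [lintegral_interval_region _ measurableSet_Ici (fun r => ENNReal.ofReal (r ^ (-1 - a - 1)))
      (by fun_prop), Measure.restrict_congr_set Ioi_ae_eq_Ici.symm]
    calc ∫⁻ r in Ioi (z.2 / τ), ENNReal.ofReal (r ^ (-1 - a - 1)) *
            ENNReal.ofReal (z.1 + z.2 - z.1 + r)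
        ≤ ∫⁻ r in Ioi (z.2 / τ), ENNReal.ofReal 3 * ENNReal.ofReal (r ^ (-1 - a)) := by
          refine setLIntegral_mono (by fun_prop) fun r hr => ?_
          have hr0 : 0 < r := hc.trans hr
          rw [← ENNReal.ofReal_mul (by positivity), ← ENNReal.ofReal_mul (by positivity)]
          refine ENNReal.ofReal_le_ofReal ?_
          have h1 : z.2 < r * τ := (div_lt_iff₀ (by linarith)).1 hr
          have h2 : z.1 + z.2 - z.1 + r ≤ 3 * r := by nlinarith
          calc r ^ (-1 - a - 1) * (z.1 + z.2 - z.1 + r) ≤ r ^ (-1 - a - 1) * (3 * r) := by gcongr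
            _ = 3 * (r ^ (-1 - a - 1) * r) := by ring
            _ = 3 * r ^ (-1 - a) := by rw [← Real.rpow_add_one hr0.ne']; congr 2; ring
      _ = ENNReal.ofReal 3 * ENNReal.ofReal ((z.2 / τ) ^ (-a) / a) := by
          rw [lintegral_const_mul _ (by fun_prop)]
          congr 1
          rw [← ofReal_integral_eq_lintegral_ofReal
            (integrableOn_Ioi_rpow_of_lt (by linarith) hc),
            integral_Ioi_rpow_of_lt (by linarith) hc]
          · congr 1
            rw [show -1 - a + 1 = -a by ring, neg_div_neg_eq]
          · filter_upwards [ae_restrict_mem measurableSet_Ioi] with r hr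
            exact Real.rpow_nonneg (hc.trans hr).le _
      _ ≤ ENNReal.ofReal (9 / a / μ) * ENNReal.ofReal (μ * z.2 ^ (1 + (-1 - a))) := by
          rw [← ENNReal.ofReal_mul (by positivity), ← ENNReal.ofReal_mul (by positivity), hexp]
          refine ENNReal.ofReal_le_ofReal ?_
          rw [Real.div_rpow hz0.le (by linarith), Real.rpow_neg (by linarith : 0 ≤ τ), div_inv_eq_mul]
          have h3 := one_add_inv_rpow_le ha
          have h4 : 0 ≤ z.2 ^ (-a) := by positivity
          calc 3 * (z.2 ^ (-a) * τ ^ a / a) ≤ 3 * (z.2 ^ (-a) * 3 / a) := by gcongr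
            _ = 9 / a / μ * (μ * z.2 ^ (-a)) := by field_simp; norm_num
      _ ≤ _ := by gcongr

/-! ### From increments to heavy intervals -/

/-- Jensen's inequality for powers with respect to a measure of arbitrary mass. -/
theorem rpow_lintegral_le {α : Type*} [MeasurableSpace α] (ν : Measure α) {f : α → ℝ≥0∞}
    (hf : AEMeasurable f ν) {p : ℝ} (hp : 1 ≤ p) :
    (∫⁻ x, f x ∂ν) ^ p ≤ ν univ ^ (p - 1) * ∫⁻ x, f x ^ p ∂ν := by
  have hp0 : 0 < p := by linarith
  have h := eLpNorm'_le_eLpNorm'_mul_rpow_measure_univ one_pos hp hf.aestronglyMeasurable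
  simp only [eLpNorm'_eq_lintegral_enorm, enorm_eq_self, ENNReal.rpow_one, div_one] at h
  calc (∫⁻ x, f x ∂ν) ^ p
      ≤ ((∫⁻ x, f x ^ p ∂ν) ^ (1 / p) * ν univ ^ (1 - 1 / p)) ^ p := by gcongr
    _ = _ := by
      rw [ENNReal.mul_rpow_of_nonneg _ _ hp0.le, ← ENNReal.rpow_mul, ← ENNReal.rpow_mul,
        one_div_mul_cancel hp0.ne', ENNReal.rpow_one, mul_comm]
      congr 2
      field_simp

/-- A large increment of a `C^1` function forces its derivative to have large `p`-mass. -/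
theorem increments_subset_heavyIntervals {f h : ℝ → ℝ} (hf : ∀ s, HasDerivAt f (h s) s)
    (hh : Continuous h) {p γ l : ℝ} (hp : 1 ≤ p) (hl : 0 < l) :
    {q : ℝ × ℝ | 0 < q.2 ∧ l * q.2 ^ (1 + γ / p) < |f (q.1 + q.2) - f q.1|} ⊆
      heavyIntervals (volume.withDensity fun s => ‖h s‖ₑ ^ p) γ (l ^ p) := by
  rintro ⟨s, r⟩ ⟨hr, hlt⟩
  simp only at hr hlt
  refine ⟨hr, ?_⟩
  simp only
  have hp0 : 0 < p := by linarith
  have h1 : ENNReal.ofReal (l * r ^ (1 + γ / p)) < ∫⁻ t in Icc s (s + r), ‖h t‖ₑ := by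
    calc ENNReal.ofReal (l * r ^ (1 + γ / p)) < ENNReal.ofReal |f (s + r) - f s| :=
          (ENNReal.ofReal_lt_ofReal_iff_of_nonneg (by positivity)).2 hlt
      _ = ‖∫ t in s..(s + r), h t‖ₑ := by
          rw [intervalIntegral.integral_eq_sub_of_hasDerivAt (fun t _ => hf t)
            (hh.intervalIntegrable _ _), Real.enorm_eq_ofReal_abs]
      _ ≤ ∫⁻ t in Ioc s (s + r), ‖h t‖ₑ := by
          rw [intervalIntegral.integral_of_le (by linarith)]
          exact enorm_integral_le_lintegral_enorm _
      _ ≤ _ := lintegral_mono_set Ioc_subset_Icc_self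
  have h2 := (ENNReal.rpow_lt_rpow h1 hp0).trans_le
    (rpow_lintegral_le (volume.restrict (Icc s (s + r))) hh.measurable.enorm.aemeasurable hp)
  rw [Measure.restrict_apply_univ, Real.volume_Icc, add_sub_cancel_left,
    ENNReal.ofReal_rpow_of_nonneg (by positivity) hp0.le, ENNReal.ofReal_rpow_of_pos hr,
    ← withDensity_apply _ measurableSet_Icc] at h2
  -- The exponent `γ / p` is made for this: the Jensen factor `r ^ (p - 1)` cancels and leaves the
  -- threshold `l ^ p * r ^ (1 + γ)`.
  have h3 : (l * r ^ (1 + γ / p)) ^ p = r ^ (p - 1) * (l ^ p * r ^ (1 + γ)) := by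
    rw [Real.mul_rpow hl.le (by positivity), ← Real.rpow_mul hr.le, mul_left_comm,
      ← Real.rpow_add hr]
    congr 2
    field_simp
    ring
  rw [h3, ENNReal.ofReal_mul (by positivity)] at h2
  exact lt_of_mul_lt_mul_left' h2

/-! ### Slicing, polar coordinates and the estimate for `C^1` functions -/

/-- Slicing of Lebesgue measure along a unit direction. -/
theorem exists_measurePreserving_slicing {n : ℕ} {e : Rn (n + 1)} (he : ‖e‖ = 1) :
    ∃ Φ : ℝ × (Fin n → ℝ) → Rn (n + 1), MeasurePreserving Φ ∧
      ∀ s t, Φ (s, t) = Φ (0, t) + s • e := by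
  have hv : Orthonormal ℝ (({0} : Set (Fin (n + 1))).domRestrict fun _ => e) := by
    refine ⟨fun i => he, fun i j hij => ?_⟩
    exact absurd (Subsingleton.elim i j) hij
  obtain ⟨b, hb⟩ := hv.exists_orthonormalBasis_extension_of_card_eq (by simp)
  have hb0 : b 0 = e := hb 0 rfl
  refine ⟨fun q => b.repr.symm (WithLp.toLp 2
    ((MeasurableEquiv.piFinSuccAbove (fun _ : Fin (n + 1) => ℝ) 0).symm q)), ?_, ?_⟩
  · exact b.measurePreserving_repr_symm.comp ((PiLp.volume_preserving_toLp _).comp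
      (volume_preserving_piFinSuccAbove (fun _ : Fin (n + 1) => ℝ) 0).symm)
  · intro s t
    rw [← hb0, ← b.repr_symm_single, ← map_smul, ← map_add]
    refine congrArg b.repr.symm ?_
    ext i
    refine Fin.cases ?_ (fun j => ?_) i <;>
      simp [MeasurableEquiv.piFinSuccAbove, Fin.consEquiv]

theorem lintegral_le_of_lines {n : ℕ} {e : Rn (n + 1)} (he : ‖e‖ = 1)
    {F G : Rn (n + 1) → ℝ≥0∞} (hF : Measurable F) (hG : Measurable G)
    (h : ∀ x, ∫⁻ s : ℝ, F (x + s • e) ≤ ∫⁻ s : ℝ, G (x + s • e)) :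
    ∫⁻ x, F x ≤ ∫⁻ x, G x := by
  obtain ⟨Φ, hΦ, hs⟩ := exists_measurePreserving_slicing he
  rw [← hΦ.lintegral_comp hF, ← hΦ.lintegral_comp hG, Measure.volume_eq_prod,
    lintegral_prod_symm' (fun q => F (Φ q)) (hF.comp hΦ.measurable),
    lintegral_prod_symm' (fun q => G (Φ q)) (hG.comp hΦ.measurable)]
  refine lintegral_mono fun t => ?_
  rw [lintegral_congr fun s => congrArg F (hs s t), lintegral_congr fun s => congrArg G (hs s t)]
  exact h _

/-- Integration in polar coordinates. -/
theorem lintegral_polar {N : ℕ} {F : Rn N → ℝ≥0∞} (hF : Measurable F) (hN : 1 ≤ N) :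
    ∫⁻ h, F h = ∫⁻ e, (∫⁻ r in Ioi (0 : ℝ), ENNReal.ofReal (r ^ (N - 1)) * F (r • (e : Rn N)))
      ∂(volume : Measure (Rn N)).toSphere := by
  have : Nontrivial (Rn N) := by
    obtain ⟨n, rfl⟩ : ∃ n, N = n + 1 := ⟨N - 1, by omega⟩
    infer_instance
  have hmp := (volume : Measure (Rn N)).measurePreserving_homeomorphUnitSphereProd
  rw [finrank_euclideanSpace_fin] at hmp
  have hG : Measurable fun y : Metric.sphere (0 : Rn N) 1 × Ioi (0 : ℝ) =>
      F ((y.2 : ℝ) • (y.1 : Rn N)) := by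
    refine hF.comp ?_
    fun_prop
  calc ∫⁻ h, F h = ∫⁻ h in {0}ᶜ, F h := by rw [restrict_compl_singleton]
    _ = ∫⁻ h : ({0}ᶜ : Set (Rn N)), F h ∂((volume : Measure (Rn N)).comap Subtype.val) :=
        (lintegral_subtype_comap (measurableSet_singleton _).compl F).symm
    _ = ∫⁻ y, F ((y.2 : ℝ) • (y.1 : Rn N)) ∂((volume : Measure (Rn N)).toSphere.prod
          (Measure.volumeIoiPow (N - 1))) := by
        rw [← hmp.lintegral_comp hG]
        refine lintegral_congr fun h => ?_
        congr 1
        rw [← homeomorphUnitSphereProd_symm_apply_coe, Homeomorph.symm_apply_apply]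
    _ = _ := by
        rw [lintegral_prod _ hG.aemeasurable]
        refine lintegral_congr fun e => ?_
        rw [Measure.volumeIoiPow, lintegral_withDensity_eq_lintegral_mul _ (by fun_prop)
          (g := fun r : Ioi (0 : ℝ) => F ((r : ℝ) • (e : Rn N))) (hG.comp measurable_prodMk_left)]
        exact lintegral_subtype_comap measurableSet_Ioi
          (fun r : ℝ => ENNReal.ofReal (r ^ (N - 1)) * F (r • (e : Rn N)))

/-- The estimate for increments of a `C^1` function in a fixed direction. -/
theorem lintegral_increments_direction {n : ℕ} {u : Rn (n + 1) → ℝ} (hu : ContDiff ℝ 1 u)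
    {e : Rn (n + 1)} (he : ‖e‖ = 1) {p γ l : ℝ} (hp : 1 ≤ p) (hl : 0 < l) {k : ℝ≥0∞}
    (hk : ∀ m : Measure ℝ, ∫⁻ q in heavyIntervals m γ (l ^ p), ENNReal.ofReal (q.2 ^ (γ - 1)) ≤
      k * m univ) :
    ∫⁻ r in Ioi (0 : ℝ), ENNReal.ofReal (r ^ (γ - 1)) *
        volume {x | l * r ^ (1 + γ / p) < |u (x + r • e) - u x|} ≤
      k * ∫⁻ x, ‖fderiv ℝ u x e‖ₑ ^ p := by
  have huc : Continuous u := hu.continuous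
  set B : Set (Rn (n + 1) × ℝ) :=
    {q | 0 < q.2 ∧ l * q.2 ^ (1 + γ / p) < |u (q.1 + q.2 • e) - u q.1|} with hB
  have hBm : MeasurableSet B := by
    refine (measurableSet_lt measurable_const measurable_snd).inter
      (measurableSet_lt (f := fun q : Rn (n + 1) × ℝ => l * q.2 ^ (1 + γ / p)) (by fun_prop) ?_)
    exact (by fun_prop : Continuous fun q : Rn (n + 1) × ℝ =>
      |u (q.1 + q.2 • e) - u q.1|).measurable
  set W : Rn (n + 1) × ℝ → ℝ≥0∞ := B.indicator fun q => ENNReal.ofReal (q.2 ^ (γ - 1)) with hW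
  have hWm : Measurable W := Measurable.indicator (by fun_prop) hBm
  have hD : Continuous fun x => fderiv ℝ u x e :=
    (hu.continuous_fderiv (by norm_num)).clm_apply continuous_const
  calc ∫⁻ r in Ioi (0 : ℝ), ENNReal.ofReal (r ^ (γ - 1)) *
        volume {x | l * r ^ (1 + γ / p) < |u (x + r • e) - u x|}
      = ∫⁻ r, ∫⁻ x, W (x, r) := by
        rw [← lintegral_indicator measurableSet_Ioi]
        refine lintegral_congr fun r => ?_
        by_cases hr : 0 < r
        · rw [indicator_of_mem (mem_Ioi.2 hr), ← setLIntegral_const, ← lintegral_indicator]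
          · refine lintegral_congr fun x => ?_
            simp [hW, hB, indicator, hr]
          · exact measurableSet_lt measurable_const
              (by fun_prop : Continuous fun x => |u (x + r • e) - u x|).measurable
        · rw [indicator_of_notMem (by simpa using hr)]
          simp [hW, hB, hr]
    _ = ∫⁻ x, ∫⁻ r, W (x, r) := lintegral_lintegral_swap
        (f := fun r x => W (x, r)) (hWm.comp measurable_swap).aemeasurable
    _ ≤ ∫⁻ x, k * ‖fderiv ℝ u x e‖ₑ ^ p := by
        refine lintegral_le_of_lines he hWm.lintegral_prod_right'
          ((hD.measurable.enorm.pow_const p).const_mul k) fun x => ?_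
        have hder : ∀ s : ℝ, HasDerivAt (fun s : ℝ => u (x + s • e))
            (fderiv ℝ u (x + s • e) e) s := by
          intro s
          have h1 : HasDerivAt (fun s : ℝ => x + s • e) e s := by
            simpa using ((hasDerivAt_id s).smul_const e).const_add x
          exact ((hu.differentiable (by norm_num)) _).hasFDerivAt.comp_hasDerivAt s h1
        have hc : Continuous fun s : ℝ => fderiv ℝ u (x + s • e) e := hD.comp (by fun_prop)
        rw [lintegral_const_mul _ (hc.measurable.enorm.pow_const p)]
        have h2 := hk (volume.withDensity fun s : ℝ => ‖fderiv ℝ u (x + s • e) e‖ₑ ^ p)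
        rw [withDensity_apply _ MeasurableSet.univ, Measure.restrict_univ] at h2
        refine le_trans (le_of_eq ?_) ((lintegral_mono_set
          (increments_subset_heavyIntervals (γ := γ) hder hc hp hl)).trans h2)
        have hm : MeasurableSet {q : ℝ × ℝ | 0 < q.2 ∧ l * q.2 ^ (1 + γ / p) <
            |u (x + (q.1 + q.2) • e) - u (x + q.1 • e)|} := by
          refine (measurableSet_lt measurable_const measurable_snd).inter
            (measurableSet_lt (f := fun q : ℝ × ℝ => l * q.2 ^ (1 + γ / p)) (by fun_prop) ?_)
          exact (by fun_prop : Continuous fun q : ℝ × ℝ =>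
            |u (x + (q.1 + q.2) • e) - u (x + q.1 • e)|).measurable
        rw [← lintegral_indicator hm, Measure.volume_eq_prod, lintegral_prod]
        · refine lintegral_congr fun s => lintegral_congr fun r => ?_
          simp [hW, hB, indicator, add_smul, add_assoc]
        · exact (Measurable.indicator (by fun_prop) hm).aemeasurable
    _ = _ := lintegral_const_mul _ (hD.measurable.enorm.pow_const p)

theorem measurableSet_superlevel {N : ℕ} {u : Rn N → ℝ} (hu : Continuous u) (l b : ℝ) :
    MeasurableSet (superlevel l b u) := by
  refine MeasurableSet.inter (s₁ := {z : Rn N × Rn N | z.1 ≠ z.2})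
    (s₂ := {z : Rn N × Rn N | l < |quot b u z.1 z.2|})
    (measurableSet_eq_fun measurable_fst measurable_snd).compl
    (measurableSet_lt measurable_const ?_)
  have h1 : Measurable fun z : Rn N × Rn N => u z.1 - u z.2 :=
    (by fun_prop : Continuous fun z : Rn N × Rn N => u z.1 - u z.2).measurable
  unfold quot
  exact (h1.div (by fun_prop)).abs

/-- The shear `(x, h) ↦ (x, x + h)` preserves volume. Polar coordinates in `h` then combine the
Jacobian `r ^ (N - 1)` with the kernel `r ^ (γ - N)` into `r ^ (γ - 1)`, removing the dimension from
the radial weight. -/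
theorem nu_superlevel_eq {N : ℕ} (hN : 1 ≤ N) {u : Rn N → ℝ} (hu : Continuous u) (γ l b : ℝ) :
    nu N γ (superlevel l b u) =
      ∫⁻ e, (∫⁻ r in Ioi (0 : ℝ), ENNReal.ofReal (r ^ (γ - 1)) *
        volume {x | l * r ^ (1 + b) < |u (x + r • (e : Rn N)) - u x|})
        ∂(volume : Measure (Rn N)).toSphere := by
  have hE := measurableSet_superlevel hu l b
  have hsub : superlevel l b u ⊆ {z : Rn N × Rn N | z.1 ≠ z.2} := fun z hz => hz.1
  set w : Rn N × Rn N → ℝ≥0∞ := fun z => ENNReal.ofReal (‖z.1 - z.2‖ ^ (γ - (N : ℝ))) with hw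
  have hwm : Measurable w := by fun_prop
  set V : Rn N → ℝ≥0∞ := fun h => volume {x | l * ‖h‖ ^ (1 + b) < |u (x + h) - u x|} with hV
  have hSm : MeasurableSet {z : Rn N × Rn N | l * ‖z.2‖ ^ (1 + b) < |u (z.1 + z.2) - u z.1|} :=
    measurableSet_lt (by fun_prop)
      (by fun_prop : Continuous fun z : Rn N × Rn N => |u (z.1 + z.2) - u z.1|).measurable
  have hVm : Measurable V := measurable_measure_prodMk_right hSm
  have hmp : MeasurePreserving (fun z : Rn N × Rn N => (z.1, z.1 + z.2)) volume volume :=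
    measurePreserving_prod_add volume volume
  calc nu N γ (superlevel l b u) = ∫⁻ z, (superlevel l b u).indicator w z := by
        rw [nu, withDensity_apply _ hE, Measure.restrict_restrict hE,
          inter_eq_left.2 hsub, lintegral_indicator hE]
    _ = ∫⁻ z : Rn N × Rn N, (superlevel l b u).indicator w (z.1, z.1 + z.2) :=
        (hmp.lintegral_comp (hwm.indicator hE)).symm
    _ = ∫⁻ h, ∫⁻ x, (superlevel l b u).indicator w (x, x + h) := by
        rw [Measure.volume_eq_prod,
          lintegral_prod_symm' (fun z : Rn N × Rn N => (superlevel l b u).indicator w (z.1, z.1 + z.2))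
            ((hwm.indicator hE).comp hmp.measurable)]
    _ = ∫⁻ h, ({0}ᶜ : Set (Rn N)).indicator
          (fun h => ENNReal.ofReal (‖h‖ ^ (γ - (N : ℝ))) * V h) h := by
        refine lintegral_congr fun h => ?_
        by_cases hh : h = 0
        · simp [hh, superlevel]
        · have hn : 0 < ‖h‖ ^ (1 + b) := Real.rpow_pos_of_pos (norm_pos_iff.2 hh) _
          rw [indicator_of_mem (by simpa using hh), hV, ← setLIntegral_const,
            ← lintegral_indicator (s := {x | l * ‖h‖ ^ (1 + b) < |u (x + h) - u x|})
              (measurable_prodMk_right hSm)]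
          refine lintegral_congr fun x => ?_
          simp only [indicator, superlevel, quot, hw, mem_ofPred_eq, sub_add_cancel_left, norm_neg,
            abs_div, abs_of_pos hn, lt_div_iff₀ hn, abs_sub_comm (u x)]
          simp [hh]
    _ = _ := by
        rw [lintegral_polar (Measurable.indicator (by fun_prop)
          (measurableSet_singleton _).compl) hN]
        refine lintegral_congr fun e => setLIntegral_congr_fun measurableSet_Ioi fun r hr => ?_
        have hr0 : 0 < r := hr
        have he : ‖(e : Rn N)‖ = 1 := by simp
        have hne : r • (e : Rn N) ≠ 0 := by
          rw [← norm_ne_zero_iff, norm_smul, he, Real.norm_of_nonneg hr0.le]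
          simpa using hr0.ne'
        rw [indicator_of_mem (by simpa using hne), hV]
        simp only [norm_smul, he, Real.norm_of_nonneg hr0.le, mul_one]
        rw [← mul_assoc, ← ENNReal.ofReal_mul (by positivity), ← Real.rpow_natCast,
          ← Real.rpow_add hr0, Nat.cast_sub hN]
        congr 3
        push_cast
        ring

/-- The weak-type estimate for a `C^1` function, given control of its directional derivatives. -/
theorem nu_superlevel_le {N : ℕ} (hN : 1 ≤ N) {u : Rn N → ℝ} (hu : ContDiff ℝ 1 u)
    {p γ l : ℝ} (hp : 1 ≤ p) (hl : 0 < l) {k A : ℝ≥0∞}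
    (hk : ∀ m : Measure ℝ, ∫⁻ q in heavyIntervals m γ (l ^ p), ENNReal.ofReal (q.2 ^ (γ - 1)) ≤
      k * m univ)
    (hA : ∀ e : Rn N, ‖e‖ = 1 → ∫⁻ x, ‖fderiv ℝ u x e‖ₑ ^ p ≤ A) :
    nu N γ (superlevel l (γ / p) u) ≤ k * A * ENNReal.ofReal (sphereArea N) := by
  rw [nu_superlevel_eq hN hu.continuous, sphereArea, ofReal_measureReal, ← lintegral_const]
  refine lintegral_mono fun e => ?_
  have he : ‖(e : Rn N)‖ = 1 := by simp
  obtain ⟨n, rfl⟩ : ∃ n, N = n + 1 := ⟨N - 1, by omega⟩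
  refine (lintegral_increments_direction hu he hp hl hk).trans ?_
  gcongr
  exact hA _ he

/-! ### Mollification and passage to the limit -/

/-- The mollification of `u` by a normalized bump function. -/
noncomputable def mollify {N : ℕ} (φ : ContDiffBump (0 : Rn N)) (u : Rn N → ℝ) : Rn N → ℝ :=
  φ.normed volume ⋆[ContinuousLinearMap.lsmul ℝ ℝ, volume] u

theorem contDiff_mollify {N : ℕ} (φ : ContDiffBump (0 : Rn N)) {u : Rn N → ℝ}
    (hu : LocallyIntegrable u) : ContDiff ℝ 1 (mollify φ u) :=
  φ.hasCompactSupport_normed.contDiff_convolution_left (n := 1) _ φ.contDiff_normed hu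

theorem fderiv_mollify_apply {N : ℕ} (φ : ContDiffBump (0 : Rn N)) {u : Rn N → ℝ}
    (hu : LocallyIntegrable u) (x e : Rn N) :
    fderiv ℝ (mollify φ u) x e = ∫ t, fderiv ℝ (φ.normed volume) (x - t) e * u t := by
  have h := (φ.hasCompactSupport_normed (μ := volume)).hasFDerivAt_convolution_left
    (ContinuousLinearMap.lsmul ℝ ℝ) φ.contDiff_normed hu x
  have hex : ConvolutionExists (fderiv ℝ (φ.normed volume)) u
      ((ContinuousLinearMap.lsmul ℝ ℝ).precompL (Rn N)) volume :=
    (φ.hasCompactSupport_normed.fderiv ℝ).convolutionExists_left _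
      ((φ.contDiff_normed (n := 1)).continuous_fderiv (by norm_num)) hu
  rw [mollify, h.fderiv, convolution_eq_swap, ContinuousLinearMap.integral_apply]
  · rfl
  · exact (hex x).integrable_swap

/-- Passing a weak-type bound from all mollifications to the limit. -/
theorem nu_superlevel_le_of_mollify {N : ℕ} {u : Rn N → ℝ} (hu : LocallyIntegrable u)
    {γ l b : ℝ} {M : ℝ≥0∞}
    (h : ∀ φ : ContDiffBump (0 : Rn N), nu N γ (superlevel l b (mollify φ u)) ≤ M) :
    nu N γ (superlevel l b u) ≤ M := by
  let φ : ℕ → ContDiffBump (0 : Rn N) := fun n =>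
    ⟨1 / ((n : ℝ) + 1), 2 * (1 / ((n : ℝ) + 1)), by positivity, by
      have : 0 < 1 / ((n : ℝ) + 1) := by positivity
      linarith⟩
  have hφ : Tendsto (fun n => (φ n).rOut) atTop (𝓝 0) := by
    have h0 := (tendsto_one_div_add_atTop_nhds_zero_nat (𝕜 := ℝ)).const_mul 2
    rwa [mul_zero] at h0
  have hae : ∀ᵐ x : Rn N, Tendsto (fun n => mollify (φ n) u x) atTop (𝓝 (u x)) :=
    ContDiffBump.ae_convolution_tendsto_right_of_locallyIntegrable (K := 2) hφ
      (Eventually.of_forall fun n => le_rfl) hu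
  have hae2 : ∀ᵐ z ∂nu N γ, Tendsto (fun n => mollify (φ n) u z.1) atTop (𝓝 (u z.1)) ∧
      Tendsto (fun n => mollify (φ n) u z.2) atTop (𝓝 (u z.2)) := by
    have hac : nu N γ ≪ (volume : Measure (Rn N)).prod volume :=
      (withDensity_absolutelyContinuous _ _).trans Measure.restrict_le_self.absolutelyContinuous
    refine hac.ae_le ?_
    exact (Measure.quasiMeasurePreserving_fst.ae hae).and
      (Measure.quasiMeasurePreserving_snd.ae hae)
  have hsub : superlevel l b u ≤ᵐ[nu N γ]
      ⋃ m : ℕ, ⋂ n ≥ m, superlevel l b (mollify (φ n) u) := by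
    filter_upwards [hae2] with z hz hzu
    have ht : Tendsto (fun n => |quot b (mollify (φ n) u) z.1 z.2|) atTop
        (𝓝 |quot b u z.1 z.2|) := ((hz.1.sub hz.2).div_const _).abs
    -- The inequality `l < |quot|` is open, so it holds for all late mollifications: the superlevel
    -- set lies a.e. in the lower limit of theirs.
    obtain ⟨m, hm⟩ := eventually_atTop.1 (ht.eventually (lt_mem_nhds hzu.2))
    exact mem_iUnion.2 ⟨m, mem_iInter₂.2 fun n hn => ⟨hzu.1, hm n hn⟩⟩
  refine (measure_mono_ae hsub).trans ?_
  rw [Monotone.measure_iUnion]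
  · exact iSup_le fun m => (measure_mono (iInter₂_subset m le_rfl)).trans (h _)
  · exact fun m m' hmm => biInter_subset_biInter_left fun n hn => le_trans hmm hn

theorem weakQuotient_le_of_mollify {N : ℕ} (hN : 1 ≤ N) {u : Rn N → ℝ} (hu : LocallyIntegrable u)
    {p γ c : ℝ} (hp : 1 ≤ p) (hc : 0 ≤ c) {A : ℝ≥0∞}
    (hk : ∀ (m : Measure ℝ) (μ : ℝ), 0 < μ →
      ∫⁻ q in heavyIntervals m γ μ, ENNReal.ofReal (q.2 ^ (γ - 1)) ≤
        ENNReal.ofReal (c / μ) * m univ)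
    (hA : ∀ (φ : ContDiffBump (0 : Rn N)) (e : Rn N), ‖e‖ = 1 →
      ∫⁻ x, ‖fderiv ℝ (mollify φ u) x e‖ₑ ^ p ≤ A) :
    weakQuotient p γ u ≤ ENNReal.ofReal (c * sphereArea N) * A := by
  refine iSup₂_le fun l hl => ?_
  have hlp : 0 < l ^ p := Real.rpow_pos_of_pos hl p
  have h := nu_superlevel_le_of_mollify (γ := γ) (l := l) (b := γ / p) hu fun φ =>
    nu_superlevel_le hN (contDiff_mollify φ hu) hp hl (fun m => hk m _ hlp) (hA φ)
  calc ENNReal.ofReal (l ^ p) * nu N γ (superlevel l (γ / p) u)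
      ≤ ENNReal.ofReal (l ^ p) *
          (ENNReal.ofReal (c / l ^ p) * A * ENNReal.ofReal (sphereArea N)) := by gcongr
    _ = ENNReal.ofReal (l ^ p * (c / l ^ p)) * ENNReal.ofReal (sphereArea N) * A := by
        rw [ENNReal.ofReal_mul hlp.le]
        ring
    _ = _ := by rw [mul_div_cancel₀ _ hlp.ne', ENNReal.ofReal_mul hc]

/-! ### Derivatives of mollifications: the Sobolev case -/

theorem lintegral_normed_sub {N : ℕ} (φ : ContDiffBump (0 : Rn N)) (x : Rn N) :
    ∫⁻ t, ENNReal.ofReal (φ.normed volume (x - t)) = 1 := by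
  rw [lintegral_sub_left_eq_self (fun t => ENNReal.ofReal (φ.normed volume t)) x,
    ← ofReal_integral_eq_lintegral_ofReal φ.integrable_normed
      (Eventually.of_forall φ.nonneg_normed), φ.integral_normed, ENNReal.ofReal_one]

theorem lintegral_normed_sub_right {N : ℕ} (φ : ContDiffBump (0 : Rn N)) (t : Rn N) :
    ∫⁻ x, ENNReal.ofReal (φ.normed volume (x - t)) = 1 := by
  rw [← lintegral_normed_sub φ t]
  refine lintegral_congr fun x => ?_
  rw [← φ.normed_neg, neg_sub]

/-- The translated reflected bump is a test function for the weak gradient; the sign from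
integration by parts cancels that of the reflection. Coordinate directions come first and linearity
gives the rest. -/
theorem fderiv_mollify_eq_inner {N : ℕ} (φ : ContDiffBump (0 : Rn N)) {u : Rn N → ℝ}
    (hu : LocallyIntegrable u) {g : Rn N → Rn N} (hg : HasWeakGradient u g) (x e : Rn N) :
    fderiv ℝ (mollify φ u) x e = inner ℝ e (∫ t, φ.normed volume (x - t) • g t) := by
  have hcs : HasCompactSupport fun t => φ.normed volume (x - t) :=
    φ.hasCompactSupport_normed.comp_homeomorph (Homeomorph.subLeft x)
  have hsm : ContDiff ℝ ∞ fun t => φ.normed volume (x - t) :=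
    φ.contDiff_normed.comp (contDiff_const.sub contDiff_id)
  have hint : Integrable fun t => φ.normed volume (x - t) • g t :=
    hg.1.integrable_smul_left_of_hasCompactSupport hsm.continuous hcs
  have hcoord : ∀ i : Fin N, fderiv ℝ (mollify φ u) x (EuclideanSpace.single i 1) =
      (∫ t, φ.normed volume (x - t) • g t) i := by
    intro i
    have h1 := hg.2 _ hsm hcs i
    have h2 : ∀ t w, fderiv ℝ (fun t => φ.normed volume (x - t)) t w =
        -fderiv ℝ (φ.normed volume) (x - t) w := by
      intro t w
      have hd : DifferentiableAt ℝ (φ.normed volume) (x - t) :=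
        (φ.contDiff_normed (n := 1)).differentiable (by norm_num) _
      have h3 := hd.hasFDerivAt.comp t ((hasFDerivAt_id t).const_sub x)
      have h4 : fderiv ℝ (fun t => φ.normed volume (x - t)) t = _ := h3.fderiv
      rw [h4]
      simp
    simp only [h2, mul_neg, integral_neg, neg_inj] at h1
    rw [fderiv_mollify_apply φ hu]
    have h5 : ∫ t, (φ.normed volume (x - t) • g t) i = (∫ t, φ.normed volume (x - t) • g t) i :=
      (EuclideanSpace.proj (𝕜 := ℝ) i).integral_comp_comm hint
    rw [← h5]
    simp only [mul_comm (fderiv ℝ _ _ _)]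
    rw [h1]
    refine integral_congr_ae (Eventually.of_forall fun t => ?_)
    simp [mul_comm]
  have he : e = ∑ i, e i • EuclideanSpace.single i (1 : ℝ) := by
    ext j
    simp [Finset.sum_apply, Pi.single_apply]
  conv_lhs => rw [he]
  simp only [map_sum, map_smul, hcoord, PiLp.inner_apply]
  refine Finset.sum_congr rfl fun i _ => ?_
  simp [mul_comm]

/-- The kernel of mollification, with values in `[0, ∞]`. -/
noncomputable def mollifier {N : ℕ} (φ : ContDiffBump (0 : Rn N)) (x t : Rn N) : ℝ≥0∞ :=
  ENNReal.ofReal (φ.normed volume (x - t))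

theorem measurable_mollifier {N : ℕ} (φ : ContDiffBump (0 : Rn N)) :
    Measurable (Function.uncurry (mollifier φ)) :=
  (φ.continuous_normed.comp (continuous_fst.sub continuous_snd)).measurable.ennreal_ofReal

theorem enorm_fderiv_mollify_le {N : ℕ} (φ : ContDiffBump (0 : Rn N))
    {u : Rn N → ℝ} (hu : LocallyIntegrable u) {g : Rn N → Rn N} (hg : HasWeakGradient u g)
    (x : Rn N) {e : Rn N} (he : ‖e‖ = 1) :
    ‖fderiv ℝ (mollify φ u) x e‖ₑ ≤ ∫⁻ t, mollifier φ x t * ‖g t‖ₑ := by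
  rw [fderiv_mollify_eq_inner φ hu hg]
  calc ‖inner ℝ e (∫ t, φ.normed volume (x - t) • g t)‖ₑ
      ≤ ‖∫ t, φ.normed volume (x - t) • g t‖ₑ := by
        refine enorm_le_iff_norm_le.2 ((norm_inner_le_norm _ _).trans ?_)
        rw [he, one_mul]
    _ ≤ ∫⁻ t, ‖φ.normed volume (x - t) • g t‖ₑ := enorm_integral_le_lintegral_enorm _
    _ = _ := by
        refine lintegral_congr fun t => ?_
        rw [enorm_smul, Real.enorm_of_nonneg (φ.nonneg_normed _), mollifier]

theorem rpow_lintegral_mollifier_le {N : ℕ} (φ : ContDiffBump (0 : Rn N)) {f : Rn N → ℝ≥0∞}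
    (hf : AEMeasurable f) {p : ℝ} (hp : 1 ≤ p) (x : Rn N) :
    (∫⁻ t, mollifier φ x t * f t) ^ p ≤ ∫⁻ t, mollifier φ x t * f t ^ p := by
  have hk : Measurable (mollifier φ x) := (measurable_mollifier φ).of_uncurry_left
  have h := rpow_lintegral_le (volume.withDensity (mollifier φ x))
    (hf.mono_ac (withDensity_absolutelyContinuous _ _)) hp
  have h1 : ∫⁻ t, mollifier φ x t = 1 := lintegral_normed_sub φ x
  rw [withDensity_apply _ MeasurableSet.univ, Measure.restrict_univ, h1, ENNReal.one_rpow, one_mul,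
    lintegral_withDensity_eq_lintegral_mul₀ hk.aemeasurable hf,
    lintegral_withDensity_eq_lintegral_mul₀ hk.aemeasurable (hf.pow_const p)] at h
  exact h

theorem lintegral_lintegral_mollifier {N : ℕ} (φ : ContDiffBump (0 : Rn N)) {f : Rn N → ℝ≥0∞}
    (hf : AEMeasurable f) : ∫⁻ x, ∫⁻ t, mollifier φ x t * f t = ∫⁻ t, f t := by
  have hm : AEMeasurable (Function.uncurry fun x t => mollifier φ x t * f t)
      ((volume : Measure (Rn N)).prod volume) :=
    AEMeasurable.mul (f := Function.uncurry (mollifier φ)) (g := fun z : Rn N × Rn N => f z.2)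
      (measurable_mollifier φ).aemeasurable hf.comp_snd
  rw [lintegral_lintegral_swap hm]
  refine lintegral_congr fun t => ?_
  have h1 : ∫⁻ x, mollifier φ x t = 1 := lintegral_normed_sub_right φ t
  rw [lintegral_mul_const (f := fun x => mollifier φ x t) _
    (measurable_mollifier φ).of_uncurry_right, h1, one_mul]

/-- The kernel has mass one in each variable: in `t` this gives Jensen without a constant, in `x` it
removes the kernel after Tonelli. -/
theorem lintegral_fderiv_mollify_le_of_hasWeakGradient {N : ℕ} (φ : ContDiffBump (0 : Rn N))
    {u : Rn N → ℝ} (hu : LocallyIntegrable u) {g : Rn N → Rn N} (hg : HasWeakGradient u g)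
    {p : ℝ} (hp : 1 ≤ p) {e : Rn N} (he : ‖e‖ = 1) :
    ∫⁻ x, ‖fderiv ℝ (mollify φ u) x e‖ₑ ^ p ≤ eLpNorm g (ENNReal.ofReal p) volume ^ p := by
  have hp0 : 0 < p := by linarith
  have hgm : AEMeasurable (fun t => ‖g t‖ₑ) volume := hg.1.aestronglyMeasurable.enorm
  calc ∫⁻ x, ‖fderiv ℝ (mollify φ u) x e‖ₑ ^ p
      ≤ ∫⁻ x, ∫⁻ t, mollifier φ x t * ‖g t‖ₑ ^ p :=
        lintegral_mono fun x =>
          (ENNReal.rpow_le_rpow (enorm_fderiv_mollify_le φ hu hg x he) hp0.le).trans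
            (rpow_lintegral_mollifier_le φ hgm hp x)
    _ = ∫⁻ t, ‖g t‖ₑ ^ p := lintegral_lintegral_mollifier φ (hgm.pow_const p)
    _ = _ := by
        rw [eLpNorm_eq_lintegral_rpow_enorm_toReal (by simpa using hp0) ENNReal.ofReal_ne_top,
          ENNReal.toReal_ofReal hp0.le, ← ENNReal.rpow_mul, one_div_mul_cancel hp0.ne',
          ENNReal.rpow_one]

/-! ### Derivatives of mollifications: the BV case -/

theorem divergence_smul_const {N : ℕ} {η : Rn N → ℝ} {x : Rn N} (hη : DifferentiableAt ℝ η x)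
    (e : Rn N) : divergence (fun t => η t • e) x = fderiv ℝ η x e := by
  have he : e = ∑ i, e i • EuclideanSpace.single i (1 : ℝ) := by
    ext j
    simp [Finset.sum_apply, Pi.single_apply]
  rw [divergence, fderiv_smul_const hη e]
  conv_rhs => rw [he]
  simp [mul_comm]

theorem fderiv_normed_neg {N : ℕ} (φ : ContDiffBump (0 : Rn N)) (x e : Rn N) :
    fderiv ℝ (φ.normed volume) (-x) e = -fderiv ℝ (φ.normed volume) x e := by
  have hd : DifferentiableAt ℝ (φ.normed volume) (-x) :=
    (φ.contDiff_normed (n := 1)).differentiable (by norm_num) _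
  have h1 := hd.hasFDerivAt.comp x (hasFDerivAt_id x).neg
  have h2 : (φ.normed volume) ∘ Neg.neg = φ.normed (volume : Measure (Rn N)) := by
    ext t
    simp [φ.normed_neg]
  rw [h2] at h1
  rw [h1.fderiv]
  simp

/-- Testing the derivative of a mollification against a continuous function. -/
theorem ofReal_abs_integral_mul_fderiv_mollify_le {N : ℕ} (φ : ContDiffBump (0 : Rn N))
    {u : Rn N → ℝ} (hu : LocallyIntegrable u) {e : Rn N} (he : ‖e‖ = 1)
    {θ : Rn N → ℝ} (hθ : Continuous θ) (hθc : HasCompactSupport θ) (hθ1 : ∀ x, |θ x| ≤ 1) :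
    ENNReal.ofReal |∫ x, θ x * fderiv ℝ (mollify φ u) x e| ≤ totalVariation u := by
  set ψ : Rn N → ℝ := φ.normed volume with hψ
  have hψ1 : ContDiff ℝ 1 ψ := φ.contDiff_normed
  have hψc : HasCompactSupport ψ := φ.hasCompactSupport_normed
  set F : Rn N → ℝ := fun t => fderiv ℝ ψ t e with hF
  have hFc : Continuous F := (hψ1.continuous_fderiv (by norm_num)).clm_apply continuous_const
  have hFs : HasCompactSupport F := hψc.fderiv_apply (𝕜 := ℝ) e
  -- The mollifier is moved onto the test function: `η • e` is an admissible field, since averaging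
  -- keeps `|η| ≤ 1`.
  set η : Rn N → ℝ := θ ⋆[ContinuousLinearMap.lsmul ℝ ℝ, volume] ψ with hη
  have hθl : LocallyIntegrable θ := hθ.locallyIntegrable
  have hη1 : ContDiff ℝ 1 η := hψc.contDiff_convolution_right (n := 1) _ hθl hψ1
  have hηc : HasCompactSupport η := hθc.convolution _ hψc
  have hηd : ∀ t, fderiv ℝ η t e = ∫ x, θ x * F (t - x) := by
    intro t
    have h := hψc.hasFDerivAt_convolution_right (ContinuousLinearMap.lsmul ℝ ℝ) hθl hψ1 t
    have hex : ConvolutionExists θ (fderiv ℝ ψ)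
        ((ContinuousLinearMap.lsmul ℝ ℝ).precompR (Rn N)) volume :=
      (hψc.fderiv ℝ).convolutionExists_right _ hθl (hψ1.continuous_fderiv (by norm_num))
    rw [hη, h.fderiv, convolution_def, ContinuousLinearMap.integral_apply]
    · rfl
    · exact hex t
  have hηb : ∀ t, |η t| ≤ 1 := by
    intro t
    have hi : Integrable fun x => ψ (t - x) := φ.integrable_normed.comp_sub_left t
    calc |η t| = ‖∫ x, θ x * ψ (t - x)‖ := rfl
      _ ≤ ∫ x, ψ (t - x) := by
          refine norm_integral_le_of_norm_le hi (Eventually.of_forall fun x => ?_)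
          rw [norm_mul, Real.norm_eq_abs, Real.norm_of_nonneg (φ.nonneg_normed _)]
          exact mul_le_of_le_one_left (φ.nonneg_normed _) (hθ1 x)
      _ = 1 := by rw [integral_sub_left_eq_self ψ volume t]; exact φ.integral_normed
  have hprod : Integrable (Function.uncurry fun x t => θ x * (F (x - t) * u t))
      ((volume : Measure (Rn N)).prod volume) := by
    -- Only `t ∈ K` contribute, so local integrability of `u` suffices for Fubini.
    set K : Set (Rn N) := (fun z : Rn N × Rn N => z.1 - z.2) '' (tsupport θ ×ˢ tsupport F) with hK
    have hKc : IsCompact K :=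
      (IsCompact.prod hθc hFs).image (by fun_prop)
    obtain ⟨C, hC⟩ := hFs.exists_bound_of_continuous hFc
    have hi1 : Integrable θ := hθ.integrable_of_hasCompactSupport hθc
    have hi2 : Integrable (K.indicator u) :=
      (hu.integrableOn_isCompact hKc).integrable_indicator hKc.measurableSet
    refine ((hi1.mul_prod hi2).const_mul C).mono ?_ (Eventually.of_forall ?_)
    · refine (hθ.comp continuous_fst).aestronglyMeasurable.mul
        (AEStronglyMeasurable.mul ?_ hu.aestronglyMeasurable.comp_snd)
      exact (hFc.comp (continuous_fst.sub continuous_snd)).aestronglyMeasurable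
    · rintro ⟨x, t⟩
      simp only [Function.uncurry_apply_pair]
      by_cases hx : θ x = 0
      · simp [hx]
      by_cases hxt : F (x - t) = 0
      · simp only [hxt, zero_mul, mul_zero, norm_zero]
        positivity
      · have htK : t ∈ K := ⟨(x, x - t), ⟨subset_tsupport _ hx, subset_tsupport _ hxt⟩, by simp⟩
        rw [indicator_of_mem htK]
        have h1 := (hC (x - t)).trans (le_abs_self C)
        simp only [norm_mul, Real.norm_eq_abs C]
        calc ‖θ x‖ * (‖F (x - t)‖ * ‖u t‖) = ‖F (x - t)‖ * (‖θ x‖ * ‖u t‖) := by ring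
          _ ≤ |C| * (‖θ x‖ * ‖u t‖) := by gcongr
  have hmain : ∫ x, θ x * fderiv ℝ (mollify φ u) x e =
      -∫ t, u t * divergence (fun t => η t • e) t := by
    calc ∫ x, θ x * fderiv ℝ (mollify φ u) x e = ∫ x, ∫ t, θ x * (F (x - t) * u t) := by
          refine integral_congr_ae (Eventually.of_forall fun x => ?_)
          simp only
          rw [fderiv_mollify_apply φ hu, integral_const_mul]
      _ = ∫ t, ∫ x, θ x * (F (x - t) * u t) := integral_integral_swap hprod
      _ = ∫ t, -(u t * divergence (fun t => η t • e) t) := by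
          refine integral_congr_ae (Eventually.of_forall fun t => ?_)
          simp only
          rw [divergence_smul_const (hη1.differentiable (by norm_num) t), hηd,
            ← integral_const_mul, ← integral_neg]
          refine integral_congr_ae (Eventually.of_forall fun x => ?_)
          have hodd : F (x - t) = -F (t - x) := by
            rw [← neg_sub t x]
            exact fderiv_normed_neg φ _ _
          simp only [hodd]
          ring
      _ = _ := integral_neg _
  rw [hmain, abs_neg]
  refine le_iSup_of_le (fun t => η t • e) (le_iSup_of_le (hη1.smul contDiff_const)
    (le_iSup_of_le hηc.smul_right (le_iSup_of_le (fun t => ?_) le_rfl)))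
  rw [norm_smul, he, mul_one]
  exact hηb t

/-- Duality: the derivative `D` is tested against a cut-off times the regularised sign `D / (|D| + 1
/ (n + 1))`, continuous and bounded by one. The products are nonnegative and tend to `|D|`, so
Fatou's lemma concludes. -/
theorem lintegral_fderiv_mollify_le_totalVariation {N : ℕ} (φ : ContDiffBump (0 : Rn N))
    {u : Rn N → ℝ} (hu : LocallyIntegrable u) {e : Rn N} (he : ‖e‖ = 1) :
    ∫⁻ x, ‖fderiv ℝ (mollify φ u) x e‖ₑ ≤ totalVariation u := by
  set D : Rn N → ℝ := fun x => fderiv ℝ (mollify φ u) x e with hD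
  have hDc : Continuous D :=
    ((contDiff_mollify φ hu).continuous_fderiv (by norm_num)).clm_apply continuous_const
  let χ : ℕ → Rn N → ℝ := fun n x => max 0 (min 1 ((n : ℝ) - ‖x‖))
  let θ : ℕ → Rn N → ℝ := fun n x => χ n x * (D x / (|D x| + 1 / ((n : ℝ) + 1)))
  have hpos : ∀ (n : ℕ) x, 0 < |D x| + 1 / ((n : ℝ) + 1) := fun n x => by positivity
  have hχc : ∀ n, Continuous (χ n) := fun n => by fun_prop
  have hθcont : ∀ n, Continuous (θ n) := fun n =>
    (hχc n).mul (hDc.div (by fun_prop) fun x => (hpos n x).ne')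
  have hθc : ∀ n, HasCompactSupport (θ n) := fun n => by
    refine HasCompactSupport.intro (isCompact_closedBall (0 : Rn N) n) fun x hx => ?_
    have hx' : (n : ℝ) - ‖x‖ ≤ 0 := by
      simp only [Metric.mem_closedBall, dist_zero_right, not_le] at hx
      linarith
    have : χ n x = 0 := max_eq_left ((min_le_right _ _).trans hx')
    simp [θ, this]
  have hχ0 : ∀ n x, 0 ≤ χ n x := fun n x => le_max_left _ _
  have hχ1 : ∀ n x, χ n x ≤ 1 := fun n x => max_le zero_le_one (min_le_left _ _)
  have hθ1 : ∀ n x, |θ n x| ≤ 1 := fun n x => by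
    rw [abs_mul, abs_div, abs_of_pos (hpos n x), abs_of_nonneg (hχ0 n x)]
    refine mul_le_one₀ (hχ1 n x) (by positivity) ?_
    rw [div_le_one (hpos n x)]
    have : 0 < 1 / ((n : ℝ) + 1) := by positivity
    linarith
  have hnn : ∀ n x, 0 ≤ θ n x * D x := fun n x => by
    have : θ n x * D x = χ n x * (D x * D x / (|D x| + 1 / ((n : ℝ) + 1))) := by
      simp only [θ]; ring
    rw [this]
    exact mul_nonneg (hχ0 n x) (div_nonneg (mul_self_nonneg _) (hpos n x).le)
  have hbound : ∀ n, ∫⁻ x, ENNReal.ofReal (θ n x * D x) ≤ totalVariation u := fun n => by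
    have hi : Integrable fun x => θ n x * D x :=
      ((hθcont n).mul hDc).integrable_of_hasCompactSupport (hθc n).mul_right
    rw [← ofReal_integral_eq_lintegral_ofReal hi (Eventually.of_forall (hnn n))]
    exact (ENNReal.ofReal_le_ofReal (le_abs_self _)).trans
      (ofReal_abs_integral_mul_fderiv_mollify_le φ hu he (hθcont n) (hθc n) (hθ1 n))
  have hlim : ∀ x, Tendsto (fun n => ENNReal.ofReal (θ n x * D x)) atTop (𝓝 ‖D x‖ₑ) := fun x => by
    rw [Real.enorm_eq_ofReal_abs]
    refine ENNReal.tendsto_ofReal ?_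
    by_cases h0 : D x = 0
    · simp [h0]
    · have hχl : Tendsto (fun n => χ n x) atTop (𝓝 1) := by
        refine tendsto_const_nhds.congr' ?_
        obtain ⟨m, hm⟩ := exists_nat_ge (‖x‖ + 1)
        filter_upwards [eventually_ge_atTop m] with n hn
        have : (m : ℝ) ≤ n := by exact_mod_cast hn
        have h1 : 1 ≤ (n : ℝ) - ‖x‖ := by linarith
        simp [χ, min_eq_left h1]
      have hden : Tendsto (fun n : ℕ => |D x| + 1 / ((n : ℝ) + 1)) atTop (𝓝 (|D x| + 0)) :=
        tendsto_const_nhds.add tendsto_one_div_add_atTop_nhds_zero_nat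
      have h2 := (hχl.mul (tendsto_const_nhds.div hden (by simpa using h0) : Tendsto
        (fun n : ℕ => D x / (|D x| + 1 / ((n : ℝ) + 1))) atTop (𝓝 (D x / (|D x| + 0))))).mul_const (D x)
      have h3 : 1 * (D x / (|D x| + 0)) * D x = |D x| := by
        have : |D x| ≠ 0 := abs_ne_zero.2 h0
        field_simp
        rw [add_zero, ← sq, sq_abs]
      rw [h3] at h2
      exact h2
  calc ∫⁻ x, ‖D x‖ₑ = ∫⁻ x, liminf (fun n => ENNReal.ofReal (θ n x * D x)) atTop :=
        lintegral_congr fun x => (hlim x).liminf_eq.symm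
    _ ≤ liminf (fun n => ∫⁻ x, ENNReal.ofReal (θ n x * D x)) atTop :=
        lintegral_liminf_le fun n => ((hθcont n).mul hDc).measurable.ennreal_ofReal
    _ ≤ totalVariation u :=
        liminf_le_of_le (by isBoundedDefault) fun b hb =>
          (hb.exists.choose_spec).trans (hbound _)

/-! ### Final constants -/

theorem sphereArea_nonneg (N : ℕ) : 0 ≤ sphereArea N := measureReal_nonneg

theorem weakQuotient_le_of_pos {N : ℕ} (hN : 1 ≤ N) {u : Rn N → ℝ} (hu : LocallyIntegrable u)
    {p γ : ℝ} (hp : 1 ≤ p) (hγ : 0 < γ) {A : ℝ≥0∞}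
    (hA : ∀ (φ : ContDiffBump (0 : Rn N)) (e : Rn N), ‖e‖ = 1 →
      ∫⁻ x, ‖fderiv ℝ (mollify φ u) x e‖ₑ ^ p ≤ A) :
    weakQuotient p γ u ≤ ENNReal.ofReal (9 * sphereArea N * ((5 : ℝ) ^ γ / γ)) * A := by
  refine (weakQuotient_le_of_mollify hN hu hp (by positivity)
    (fun m μ hμ => lintegral_heavyIntervals_pos m hγ hμ) hA).trans ?_
  gcongr ENNReal.ofReal ?_ * A
  have h := sphereArea_nonneg N
  calc 3 * 2 ^ γ / γ * sphereArea N ≤ 9 * 5 ^ γ / γ * sphereArea N := by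
        gcongr <;> norm_num
    _ = _ := by ring

theorem weakQuotient_le_of_lt_neg_one {N : ℕ} (hN : 1 ≤ N) {u : Rn N → ℝ}
    (hu : LocallyIntegrable u) {p γ : ℝ} (hp : 1 ≤ p) (hγ : γ < -1) {A : ℝ≥0∞}
    (hA : ∀ (φ : ContDiffBump (0 : Rn N)) (e : Rn N), ‖e‖ = 1 →
      ∫⁻ x, ‖fderiv ℝ (mollify φ u) x e‖ₑ ^ p ≤ A) :
    weakQuotient p γ u ≤
      ENNReal.ofReal (9 * sphereArea N / |γ| * (1 + 1 / |γ + 1|)) * A := by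
  refine (weakQuotient_le_of_mollify hN hu hp (by positivity)
    (fun m μ hμ => lintegral_heavyIntervals_neg m hγ hμ) hA).trans (le_of_eq ?_)
  congr 2
  -- The constants agree exactly: `|γ| = 1 + |γ + 1|` gives `(1 + 1 / |γ + 1|) / |γ| = 1 / |γ + 1|`.
  rw [abs_of_neg (by linarith : γ < 0), abs_of_neg (by linarith : γ + 1 < 0)]
  have h1 : γ ≠ 0 := by linarith
  have h2 : γ + 1 ≠ 0 := by linarith
  field_simp
  ring

end DiffQuotient

theorem theorem2p2 :
    ∃ C : ℝ, 0 < C ∧ ∀ N : ℕ, 1 ≤ N →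
      (∀ p : ℝ, 1 ≤ p → ∀ u ∈ DiffQuotient.HomSobolev N p,
        ∀ g : DiffQuotient.Rn N → DiffQuotient.Rn N, DiffQuotient.HasWeakGradient u g →
          (∀ γ : ℝ, 0 < γ →
            DiffQuotient.weakQuotient p γ u ≤
              ENNReal.ofReal (C * DiffQuotient.sphereArea N * ((5 : ℝ) ^ γ / γ)) *
                eLpNorm g (ENNReal.ofReal p) volume ^ p) ∧
          (∀ γ : ℝ, γ < -1 →
            DiffQuotient.weakQuotient p γ u ≤
              ENNReal.ofReal (C * DiffQuotient.sphereArea N / |γ| * (1 + 1 / |γ + 1|)) *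
                eLpNorm g (ENNReal.ofReal p) volume ^ p)) ∧
      (∀ u ∈ DiffQuotient.HomBV N,
        (∀ γ : ℝ, 0 < γ →
          DiffQuotient.weakQuotient 1 γ u ≤
            ENNReal.ofReal (C * DiffQuotient.sphereArea N * ((5 : ℝ) ^ γ / γ)) *
              DiffQuotient.totalVariation u) ∧
        (∀ γ : ℝ, γ < -1 →
          DiffQuotient.weakQuotient 1 γ u ≤
            ENNReal.ofReal (C * DiffQuotient.sphereArea N / |γ| * (1 + 1 / |γ + 1|)) *
              DiffQuotient.totalVariation u)) := by
  refine ⟨9, by norm_num, fun N hN => ⟨?_, ?_⟩⟩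
  · intro p hp u hu g hg
    have hA := fun (φ : ContDiffBump (0 : DiffQuotient.Rn N)) (e : DiffQuotient.Rn N)
      (he : ‖e‖ = 1) =>
        DiffQuotient.lintegral_fderiv_mollify_le_of_hasWeakGradient φ hu.1 hg hp he
    exact ⟨fun γ hγ => DiffQuotient.weakQuotient_le_of_pos hN hu.1 hp hγ hA,
      fun γ hγ => DiffQuotient.weakQuotient_le_of_lt_neg_one hN hu.1 hp hγ hA⟩
  · intro u hu
    have hA : ∀ (φ : ContDiffBump (0 : DiffQuotient.Rn N)) (e : DiffQuotient.Rn N), ‖e‖ = 1 →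
        ∫⁻ x, ‖fderiv ℝ (DiffQuotient.mollify φ u) x e‖ₑ ^ (1 : ℝ) ≤
          DiffQuotient.totalVariation u := by
      intro φ e he
      simpa only [ENNReal.rpow_one] using
        DiffQuotient.lintegral_fderiv_mollify_le_totalVariation φ hu.1 he
    exact ⟨fun γ hγ => DiffQuotient.weakQuotient_le_of_pos hN hu.1 le_rfl hγ hA,
      fun γ hγ => DiffQuotient.weakQuotient_le_of_lt_neg_one hN hu.1 le_rfl hγ hA⟩
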